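/- **Setting.** A real number $y$ is a possible rounded value of $x$ at unit roundoff $v$ if $y=x(1+\delta)$ with $|\delta|\le v$ (standard model of floating point arithmetic). Given unit roundoffs $u_h,u>0$ and $A\in\mathbb R^{m\times n}$, the mixed precision Cholesky QR algorithm (1) computes the Gram matrix $\hat M\approx A^{\top}A$ at unit roundoff $u_h$ (the entries with $i\le j$, the others by symmetry); (2) computes at unit roundoff $u_h$ the upper triangular Cholesky factor $\hat R_h$, $\hat R_h^{\top}\hat R_h\approx\hat M$, by $(\hat R_h)_{ii}=\sqrt{s_{ii}}$ and $(\hat R_h)_{ij}=s_{ij}/(\hat R_h)_{ii}$ for $i<j$, where $s_{ij}=\hat M_{ij}-\sum_{k<i}(\hat R_h)_{ki}(\hat R_h)_{kj}$; (3) converts the entries of $\hat R_h$ to unit roundoff $u$, giving $\hat R$, and solves $Q\hat R=A$ by substitution, $Q_{lj}=\bigl(A_{lj}-\sum_{k<j}Q_{lk}\hat R_{kj}\bigr)/\hat R_{jj}$, at unit roundoff $u$. Every product, addition, division, square root and conversion is rounded once, and sums may be evaluated in any order. A matrix $\hat Q\in\mathbb R^{m\times n}$ is called a *computed Q-factor*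 of $A$ if it is a possible result of a run of this algorithm in which every computed Cholesky pivot $s_{ii}$ is positive (no breakdown). Let $\|\cdot\|$ be the spectral norm and, for $B$ of full column rank, $\kappa(B)=\|B\|\,\|B^{\dagger}\|$ with $B^{\dagger}=(B^{\top}B)^{-1}B^{\top}$. **Theorem.** Let $m,n\ge 0$. Below, $A=BD$ with $A,B\in\mathbb R^{m\times n}$, where the columns of $B$ have unit Euclidean norm and $D$ is the diagonal matrix of the column norms of $A$. 1. If no column of $A$ is zero, then for all $u_h,u>0$ a matrix $\hat Q$ is a computed Q-factor of $A$ if and only if it is a computed Q-factor of $B$. 2. For every $c>0$ there are constants $C_1,C_2>0$, depending only on $m,n,c$, such that, whenever $u_h\le c\,u^2$, $A$ has full column rank and $C_1u\,\kappa(B)\le 1$, every computed Q-factor $\hat Q$ of $A$ satisfies $$\|\hat Q^{\top}\hat Q-I\|\le C_2\,u\,\kappa(B).$$ 3. There are constants $C_1,C_2>0$, depending only on $m,n$, such that, whenever $u_h=u$, $A$ has full column rank and $C_1u\,\kappa(B)^2\le 1$, every computed Q-factor $\hat Q$ of $A$ satisfies $$\|\hat Q^{\top}\hat Q-I\|\le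 C_2\,u\,\kappa(B)^2.$$ -/

import Mathlib

open scoped Matrix.Norms.L2Operator

/-- Standard model of floating point arithmetic with unit roundoff `u`: `y` is a possible rounded
value of the exact result `x`, that is `y = x (1 + δ)` with `|δ| ≤ u`. -/
def Fl (u x y : ℝ) : Prop := ∃ δ : ℝ, |δ| ≤ u ∧ y = x * (1 + δ)

/-- `FlSum u f s x`: `x` is a possible value of `∑ i ∈ s, f i` computed with unit roundoff `u`, with
one rounding for each addition of two nonempty partial sums, in an arbitrary order of summation. -/
inductive FlSum {ι : Type} (u : ℝ) (f : ι → ℝ) : Finset ι → ℝ → Prop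
  | empty : FlSum u f ∅ 0
  | single (i : ι) : FlSum u f {i} (f i)
  | add (s t : Finset ι) (hst : Disjoint s t) (x y z : ℝ) (hs : s.Nonempty) (ht : t.Nonempty)
      (hx : FlSum u f s x) (hy : FlSum u f t y) (hz : Fl u (x + y) z) :
      FlSum u f (s.disjUnion t hst) z

/-- `x` is a possible computed value of the inner product `∑ k, a k * b k`. -/
def FlDot {ι : Type} [Fintype ι] (u : ℝ) (a b : ι → ℝ) (x : ℝ) : Prop :=
  ∃ p : ι → ℝ, (∀ k, Fl u (a k * b k) (p k)) ∧ FlSum u p Finset.univ x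

/-- `x` is a possible computed value of `c - ∑ k < i, a k * b k`. The summands are `c`, stored as
the term with index `i`, and the negatives of the rounded products. -/
def FlSubDot {n : ℕ} (u c : ℝ) (i : Fin n) (a b : Fin n → ℝ) (x : ℝ) : Prop :=
  ∃ p : Fin n → ℝ, p i = c ∧ (∀ k, k < i → Fl u (-(a k * b k)) (p k)) ∧
    FlSum u p (Finset.Iic i) x

/-- `M` is a possible computed Gram matrix `Aᵀ A` with unit roundoff `u`: the entries with `i ≤ j`
are computed, the others are copied from these. -/
def FlGram {m n : ℕ} (u : ℝ) (A : Matrix (Fin m) (Fin n) ℝ) (M : Matrix (Fin n) (Fin n) ℝ) :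
    Prop :=
  M.IsSymm ∧ ∀ i j, i ≤ j → FlDot u (fun k => A k i) (fun k => A k j) (M i j)

/-- `R` is a possible computed Cholesky factor of `M` (so `M ≈ Rᵀ R` with `R` upper triangular) with
unit roundoff `u`, where the Cholesky algorithm ran to completion (every pivot was positive). -/
def FlCholesky {n : ℕ} (u : ℝ) (M R : Matrix (Fin n) (Fin n) ℝ) : Prop :=
  (∀ i j, j < i → R i j = 0) ∧
  (∀ i, ∃ s, FlSubDot u (M i i) i (fun k => R k i) (fun k => R k i) s ∧
    0 < s ∧ Fl u (Real.sqrt s) (R i i)) ∧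
  (∀ i j, i < j → ∃ s, FlSubDot u (M i j) i (fun k => R k i) (fun k => R k j) s ∧
    Fl u (s / R i i) (R i j))

/-- `R'` is a possible result of converting the entries of `R` to the precision with unit
roundoff `u`. -/
def FlCast {n : ℕ} (u : ℝ) (R R' : Matrix (Fin n) (Fin n) ℝ) : Prop :=
  ∀ i j, Fl u (R i j) (R' i j)

/-- `Q` is a possible computed solution of `Q R = A`, for `R` upper triangular, by substitution
with unit roundoff `u`. -/
def FlTriSolve {m n : ℕ} (u : ℝ) (A : Matrix (Fin m) (Fin n) ℝ) (R : Matrix (Fin n) (Fin n) ℝ)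
    (Q : Matrix (Fin m) (Fin n) ℝ) : Prop :=
  ∀ l j, ∃ s, FlSubDot u (A l j) j (fun k => Q l k) (fun k => R k j) s ∧
    Fl u (s / R j j) (Q l j)

/-- `Q` is a possible Q-factor of `A` computed by the mixed precision Cholesky QR algorithm:
Gram matrix and Cholesky factor with unit roundoff `uh`, triangular solve with unit roundoff `u`. -/
def IsMixedCholeskyQR {m n : ℕ} (uh u : ℝ) (A Q : Matrix (Fin m) (Fin n) ℝ) : Prop :=
  ∃ M R R' : Matrix (Fin n) (Fin n) ℝ,
    FlGram uh A M ∧ FlCholesky uh M R ∧ FlCast u R R' ∧ FlTriSolve u A R' Q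

/-- Euclidean norm of the column `j` of `A`. -/
noncomputable def colNorm {m n : ℕ} (A : Matrix (Fin m) (Fin n) ℝ) (j : Fin n) : ℝ :=
  ‖WithLp.toLp 2 (A.col j)‖

/-- `A = B D` where the columns of `B` have unit norms and `D` is the diagonal matrix that contains
the column norms of `A`. -/
def IsColumnScaling {m n : ℕ} (A B : Matrix (Fin m) (Fin n) ℝ) (D : Matrix (Fin n) (Fin n) ℝ) :
    Prop :=
  A = B * D ∧ (∀ j, colNorm B j = 1) ∧ D = Matrix.diagonal (colNorm A)

/-- The Moore-Penrose inverse `(Bᵀ B)⁻¹ Bᵀ` of a matrix `B` of full column rank. -/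
noncomputable def pinv {m n : ℕ} (B : Matrix (Fin m) (Fin n) ℝ) : Matrix (Fin n) (Fin m) ℝ :=
  (B.transpose * B)⁻¹ * B.transpose

/-- Spectral condition number `κ(B) = ‖B‖ ‖B†‖` of a matrix `B` of full column rank. -/
noncomputable def condNumber {m n : ℕ} (B : Matrix (Fin m) (Fin n) ℝ) : ℝ :=
  ‖B‖ * ‖pinv B‖

section

open Matrix

/-! Relative errors do not see scale: multiplying column `j` of `A` by `d j > 0` multiplies `M i j`
by `d i * d j` and column `j` of `R` and `R'` by `d j`, with the same `δ`s, and leaves `Q`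
unchanged. So `A` may be replaced by `B`, whose unit columns turn all rounding errors into absolute
ones.

For `B`, a complete run gives `RᵀR = BᵀB + F` with `‖F‖ = O(uh)`, and `QR = B + G` with `‖G‖ = O(u)
(1 + ‖Q‖)`. If `‖B†‖² ‖F‖` is small, then `‖R⁻¹‖ = O(‖B†‖)`. Now `Q = X + Y` with `X = BR⁻¹`, `Y =
GR⁻¹`; here `XᵀX - 1 = -R⁻ᵀFR⁻¹` is `O(uh κ²)` and `Y` is `O(u κ)`. The resulting bound `K (uh κ² +
u κ)` (`exists_orthogonality_bound`) gives both regimes: `uh κ² ≤ c (u κ)² ≤ c u κ` in the first, `u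
κ ≤ u κ²` in the second. -/

/-! ### Invariance under column scaling -/

theorem Fl.const_mul {u x y : ℝ} (a : ℝ) (h : Fl u x y) : Fl u (a * x) (a * y) := by
  obtain ⟨δ, hδ, rfl⟩ := h
  exact ⟨δ, hδ, by ring⟩

theorem FlSum.const_mul {ι : Type} {u : ℝ} {f : ι → ℝ} {s : Finset ι} {x : ℝ} (a : ℝ)
    (h : FlSum u f s x) : FlSum u (fun k => a * f k) s (a * x) := by
  induction h with
  | empty => simpa using FlSum.empty
  | single i => exact FlSum.single i
  | add s t hst x y z hs ht _ _ hz ihx ihy =>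
    exact FlSum.add s t hst _ _ _ hs ht ihx ihy (by simpa [mul_add] using hz.const_mul a)

theorem FlDot.scale {ι : Type} [Fintype ι] {u : ℝ} {a b : ι → ℝ} {x : ℝ} (α β : ℝ)
    (h : FlDot u a b x) : FlDot u (fun k => a k * α) (fun k => b k * β) (α * β * x) := by
  obtain ⟨p, hp, hx⟩ := h
  refine ⟨_, fun k => ?_, hx.const_mul (α * β)⟩
  convert (hp k).const_mul (α * β) using 1
  ring

theorem FlSubDot.scale {n : ℕ} {u c : ℝ} {i : Fin n} {a b : Fin n → ℝ} {x : ℝ} (α β : ℝ)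
    (h : FlSubDot u c i a b x) :
    FlSubDot u (α * β * c) i (fun k => a k * α) (fun k => b k * β) (α * β * x) := by
  obtain ⟨p, hc, hp, hx⟩ := h
  refine ⟨_, congrArg _ hc, fun k hk => ?_, hx.const_mul (α * β)⟩
  convert (hp k hk).const_mul (α * β) using 1
  ring

/-- A computed Q-factor is unchanged by a positive scaling of the columns. -/
theorem IsMixedCholeskyQR.scale_columns {m n : ℕ} {uh u : ℝ} {A Q : Matrix (Fin m) (Fin n) ℝ}
    {d : Fin n → ℝ} (hd : ∀ j, 0 < d j) (h : IsMixedCholeskyQR uh u A Q) :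
    IsMixedCholeskyQR uh u (A * diagonal d) Q := by
  obtain ⟨M, R, R', ⟨hsymm, hM⟩, ⟨hR0, hRd, hRo⟩, hR', hQ⟩ := h
  refine ⟨of fun i j => d i * d j * M i j, R * diagonal d, R' * diagonal d, ⟨?_, ?_⟩,
    ⟨?_, ?_, ?_⟩, ?_, ?_⟩
  · ext i j
    simp [hsymm.apply i j, mul_comm (d i)]
  · intro i j hij
    simpa only [mul_diagonal, of_apply] using (hM i j hij).scale (d i) (d j)
  · intro i j hij
    simp [hR0 i j hij]
  · intro i
    obtain ⟨s, hs, hs0, hr⟩ := hRd i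
    refine ⟨d i * d i * s, ?_, by have := hd i; positivity, ?_⟩
    · simpa only [mul_diagonal, of_apply] using hs.scale (d i) (d i)
    -- Positivity of `d i` matters here: `√(d i * d i) = d i`.
    · rw [Real.sqrt_mul (mul_self_nonneg _), Real.sqrt_mul_self (hd i).le, mul_diagonal,
        mul_comm (R i i)]
      exact hr.const_mul _
  · intro i j hij
    obtain ⟨s, hs, hr⟩ := hRo i j hij
    refine ⟨d i * d j * s, ?_, ?_⟩
    · simpa only [mul_diagonal, of_apply] using hs.scale (d i) (d j)
    · rw [mul_diagonal, mul_diagonal, mul_comm (R i i), mul_assoc,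
        mul_div_mul_left _ _ (hd i).ne', mul_div_assoc, mul_comm (R i j)]
      exact hr.const_mul _
  · intro i j
    simpa only [mul_diagonal, mul_comm (d j)] using (hR' i j).const_mul (d j)
  · intro l j
    obtain ⟨s, hs, hq⟩ := hQ l j
    refine ⟨d j * s, ?_, ?_⟩
    · simpa only [mul_diagonal, mul_one, one_mul, mul_comm (d j)] using hs.scale 1 (d j)
    · rwa [mul_diagonal, mul_comm (R' j j), mul_div_mul_left _ _ (hd j).ne']

theorem colNorm_pos {m n : ℕ} {A : Matrix (Fin m) (Fin n) ℝ} {j : Fin n} (h : A.col j ≠ 0) :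
    0 < colNorm A j := by
  rw [colNorm, norm_pos_iff]
  simpa using h

theorem isMixedCholeskyQR_iff_of_isColumnScaling {m n : ℕ} {uh u : ℝ}
    {A B Q : Matrix (Fin m) (Fin n) ℝ} {D : Matrix (Fin n) (Fin n) ℝ}
    (h : IsColumnScaling A B D) (hA : ∀ j, A.col j ≠ 0) :
    IsMixedCholeskyQR uh u A Q ↔ IsMixedCholeskyQR uh u B Q := by
  obtain ⟨hAB, -, rfl⟩ := h
  have hpos := fun j => colNorm_pos (hA j)
  have hBA : B = A * diagonal fun j => (colNorm A j)⁻¹ := by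
    ext i j
    have := congrFun (congrFun hAB i) j
    rw [mul_diagonal] at this ⊢
    rw [this, mul_inv_cancel_right₀ (hpos j).ne']
  refine ⟨fun hq => ?_, fun hq => ?_⟩
  · rw [hBA]
    exact hq.scale_columns fun j => inv_pos.2 (hpos j)
  · rw [hAB]
    exact hq.scale_columns hpos

/-! ### Forward errors of sums and inner products -/

/-- The right side is the chord over `[0, 1]` of a convex function of `u`. -/
theorem one_add_pow_le {u : ℝ} (h0 : 0 ≤ u) (h1 : u ≤ 1) (N : ℕ) :
    (1 + u) ^ N ≤ 1 + (2 ^ N - 1) * u := by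
  induction N with
  | zero => simp
  | succ N ih =>
    have h2 : (1 : ℝ) ≤ 2 ^ N := one_le_pow₀ (by norm_num)
    rw [pow_succ, pow_succ]
    nlinarith [mul_nonneg (sub_nonneg.2 h2) (mul_nonneg h0 (sub_nonneg.2 h1))]

theorem Fl.abs_sub_le {u x y : ℝ} (h : Fl u x y) : |y - x| ≤ u * |x| := by
  obtain ⟨δ, hδ, rfl⟩ := h
  rw [show x * (1 + δ) - x = δ * x by ring, abs_mul]
  gcongr

/-- Both parts of an addition are nonempty, so each is smaller than the union, and the one new
factor `1 + u` fits into the exponent whatever the order of summation. -/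
theorem FlSum.abs_sub_sum_le {ι : Type} {u : ℝ} (hu : 0 ≤ u) {f : ι → ℝ} {s : Finset ι} {x : ℝ}
    (h : FlSum u f s x) :
    |x - ∑ i ∈ s, f i| ≤ ((1 + u) ^ s.card - 1) * ∑ i ∈ s, |f i| := by
  induction h with
  | empty => simp
  | single i => simpa using mul_nonneg hu (abs_nonneg _)
  | add s t hst x y z hs ht _ _ hz ihx ihy =>
    rw [Finset.sum_disjUnion, Finset.sum_disjUnion, Finset.card_disjUnion]
    set S := ∑ i ∈ s, f i
    set T := ∑ i ∈ t, f i
    set S' := ∑ i ∈ s, |f i|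
    set T' := ∑ i ∈ t, |f i|
    have hS : |S| ≤ S' := Finset.abs_sum_le_sum_abs _ _
    have hT : |T| ≤ T' := Finset.abs_sum_le_sum_abs _ _
    have hS0 : 0 ≤ S' := (abs_nonneg _).trans hS
    have hT0 : 0 ≤ T' := (abs_nonneg _).trans hT
    have h1 : (1 : ℝ) ≤ 1 + u := by linarith
    obtain ⟨k, hk⟩ : ∃ k, s.card + t.card = k + 1 :=
      ⟨s.card + t.card - 1, by have := hs.card_pos; omega⟩
    have hsk : (1 + u) ^ s.card ≤ (1 + u) ^ k :=
      pow_le_pow_right₀ h1 (by have := ht.card_pos; omega)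
    have htk : (1 + u) ^ t.card ≤ (1 + u) ^ k :=
      pow_le_pow_right₀ h1 (by have := hs.card_pos; omega)
    rw [hk, pow_succ]
    have hz' := hz.abs_sub_le
    have hxy : |x + y - (S + T)| ≤ ((1 + u) ^ k - 1) * (S' + T') := by
      calc |x + y - (S + T)| = |(x - S) + (y - T)| := by ring_nf
        _ ≤ |x - S| + |y - T| := abs_add_le _ _
        _ ≤ ((1 + u) ^ s.card - 1) * S' + ((1 + u) ^ t.card - 1) * T' := add_le_add ihx ihy
        _ ≤ ((1 + u) ^ k - 1) * S' + ((1 + u) ^ k - 1) * T' := by gcongr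
        _ = _ := by ring
    have hxy' : |x + y| ≤ |x + y - (S + T)| + (S' + T') := by
      calc |x + y| = |(x + y - (S + T)) + (S + T)| := by ring_nf
        _ ≤ |x + y - (S + T)| + |S + T| := abs_add_le _ _
        _ ≤ _ := by linarith [abs_add_le S T]
    calc |z - (S + T)| = |(z - (x + y)) + (x + y - (S + T))| := by ring_nf
      _ ≤ |z - (x + y)| + |x + y - (S + T)| := abs_add_le _ _
      _ ≤ u * (|x + y - (S + T)| + (S' + T')) + |x + y - (S + T)| := by
        gcongr
        exact hz'.trans (by gcongr)
      _ = (1 + u) * |x + y - (S + T)| + u * (S' + T') := by ring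
      _ ≤ (1 + u) * (((1 + u) ^ k - 1) * (S' + T')) + u * (S' + T') := by gcongr
      _ = _ := by ring

/-- Error bound for a computed sum of rounded terms. -/
theorem FlSum.abs_sub_sum_le_of_fl {ι : Type} {u : ℝ} (h0 : 0 ≤ u) (h1 : u ≤ 1) {p q : ι → ℝ}
    {s : Finset ι} {x : ℝ} {N : ℕ} (hN : s.card ≤ N) (hp : ∀ k ∈ s, Fl u (q k) (p k))
    (hx : FlSum u p s x) : |x - ∑ k ∈ s, q k| ≤ 2 ^ (N + 1) * u * ∑ k ∈ s, |q k| := by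
  have hsum := hx.abs_sub_sum_le h0
  have hd : |∑ k ∈ s, p k - ∑ k ∈ s, q k| ≤ u * ∑ k ∈ s, |q k| := by
    rw [← Finset.sum_sub_distrib, Finset.mul_sum]
    exact (Finset.abs_sum_le_sum_abs _ _).trans (Finset.sum_le_sum fun k hk => (hp k hk).abs_sub_le)
  have hp' : ∑ k ∈ s, |p k| ≤ (1 + u) * ∑ k ∈ s, |q k| := by
    rw [Finset.mul_sum]
    refine Finset.sum_le_sum fun k hk => ?_
    have := (hp k hk).abs_sub_le
    have := abs_sub_abs_le_abs_sub (p k) (q k)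
    linarith
  have hq : 0 ≤ ∑ k ∈ s, |q k| := Finset.sum_nonneg fun _ _ => abs_nonneg _
  have hle : (1 + u) ^ s.card ≤ (1 + u) ^ N := pow_le_pow_right₀ (by linarith) hN
  have h1N : 1 ≤ (1 + u) ^ s.card := one_le_pow₀ (by linarith)
  calc |x - ∑ k ∈ s, q k|
      = |(x - ∑ k ∈ s, p k) + (∑ k ∈ s, p k - ∑ k ∈ s, q k)| := by ring_nf
    _ ≤ |x - ∑ k ∈ s, p k| + |∑ k ∈ s, p k - ∑ k ∈ s, q k| := abs_add_le _ _
    _ ≤ ((1 + u) ^ N - 1) * ((1 + u) * ∑ k ∈ s, |q k|) + u * ∑ k ∈ s, |q k| := by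
      refine add_le_add (hsum.trans ?_) hd
      gcongr
      linarith
    _ = ((1 + u) ^ (N + 1) - 1) * ∑ k ∈ s, |q k| := by ring
    _ ≤ 2 ^ (N + 1) * u * ∑ k ∈ s, |q k| := by
      gcongr
      linarith [one_add_pow_le h0 h1 (N + 1)]

theorem FlDot.abs_sub_le {m : ℕ} {u : ℝ} (h0 : 0 ≤ u) (h1 : u ≤ 1) {a b : Fin m → ℝ} {x : ℝ}
    (h : FlDot u a b x) :
    |x - ∑ k, a k * b k| ≤ 2 ^ (m + 1) * u * ∑ k, |a k * b k| := by
  obtain ⟨p, hp, hx⟩ := h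
  exact hx.abs_sub_sum_le_of_fl h0 h1 (by simp) fun k _ => hp k

theorem FlSubDot.abs_sub_le {n : ℕ} {u : ℝ} (h0 : 0 ≤ u) (h1 : u ≤ 1) {c : ℝ} {i : Fin n}
    {a b : Fin n → ℝ} {x : ℝ} (h : FlSubDot u c i a b x) :
    |x - (c - ∑ k ∈ Finset.Iio i, a k * b k)| ≤
      2 ^ (n + 1) * u * (|c| + ∑ k ∈ Finset.Iio i, |a k * b k|) := by
  obtain ⟨p, hc, hp, hx⟩ := h
  have hI : Finset.Iic i = insert i (Finset.Iio i) := by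
    ext k
    simp [le_iff_eq_or_lt]
  have hne : ∀ k ∈ Finset.Iio i, k ≠ i := fun k hk => (Finset.mem_Iio.1 hk).ne
  let q : Fin n → ℝ := fun k => if k = i then c else -(a k * b k)
  have hq : ∀ k ∈ Finset.Iic i, Fl u (q k) (p k) := by
    intro k hk
    obtain rfl | hki := eq_or_ne k i
    -- The term `c` enters unrounded, that is with `δ = 0`.
    · exact ⟨0, by simpa using h0, by simp [q, hc]⟩
    · simpa [q, hki] using hp k (lt_of_le_of_ne (Finset.mem_Iic.1 hk) hki)
  have key := hx.abs_sub_sum_le_of_fl h0 h1 (N := n) (by simp) hq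
  have e1 : ∑ k ∈ Finset.Iic i, q k = c - ∑ k ∈ Finset.Iio i, a k * b k := by
    rw [hI, Finset.sum_insert (by simp), sub_eq_add_neg, ← Finset.sum_neg_distrib]
    exact congrArg₂ _ (by simp [q]) (Finset.sum_congr rfl fun k hk => by simp [q, hne k hk])
  have e2 : ∑ k ∈ Finset.Iic i, |q k| = |c| + ∑ k ∈ Finset.Iio i, |a k * b k| := by
    rw [hI, Finset.sum_insert (by simp)]
    exact congrArg₂ _ (by simp [q]) (Finset.sum_congr rfl fun k hk => by
      simp only [q, hne k hk, if_false, abs_neg])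
  rwa [e1, e2] at key

theorem two_le_two_pow_succ (n : ℕ) : (2 : ℝ) ≤ 2 ^ (n + 1) := by
  have : (1 : ℝ) ≤ 2 ^ n := one_le_pow₀ (by norm_num)
  rw [pow_succ]
  linarith

theorem sum_Iio_add_eq_sum_univ {n : ℕ} {f : Fin n → ℝ} {i : Fin n} (h : ∀ k, i < k → f k = 0) :
    ∑ k ∈ Finset.Iio i, f k + f i = ∑ k, f k := by
  rw [add_comm, ← Finset.sum_insert (s := Finset.Iio i) (by simp)]
  refine Finset.sum_subset (Finset.subset_univ _) fun k _ hk => h k ?_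
  simp only [Finset.mem_insert, Finset.mem_Iio, not_or, not_lt] at hk
  exact lt_of_le_of_ne hk.2 (Ne.symm hk.1)

theorem sum_Iio_le_card_mul {n : ℕ} {f : Fin n → ℝ} {i : Fin n} {c : ℝ} (hc : 0 ≤ c)
    (h : ∀ k, f k ≤ c) : ∑ k ∈ Finset.Iio i, f k ≤ n * c := by
  refine (Finset.sum_le_card_nsmul _ _ _ fun k _ => h k).trans ?_
  rw [nsmul_eq_mul]
  gcongr
  simp

/-! ### Backward errors of the Cholesky factorization and the triangular solve -/

section Cholesky

variable {n : ℕ} {u : ℝ} {M R : Matrix (Fin n) (Fin n) ℝ}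

/-- Positivity of the computed pivot alone bounds the column of `R`; definiteness of `M` plays no
role. -/
theorem FlCholesky.diag_bounds (h0 : 0 ≤ u) (hu : 2 ^ (n + 1) * u ≤ 1 / 2)
    (h : FlCholesky u M R) {i : Fin n} (hM : |M i i| ≤ 2) :
    0 < R i i ∧ (∀ k, |R k i| ≤ 3) ∧
      |∑ k, R k i * R k i - M i i| ≤ (2 ^ (n + 1) + 1) * 8 * u := by
  have hw := two_le_two_pow_succ n
  have hu4 : u ≤ 1 / 4 := by nlinarith
  obtain ⟨hR0, hRd, -⟩ := h
  obtain ⟨s, hs, hs0, δ, hδ, hr⟩ := hRd i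
  have hs' := hs.abs_sub_le h0 (by linarith)
  simp only [abs_mul_self] at hs'
  set S := ∑ k ∈ Finset.Iio i, R k i * R k i
  have hS0 : 0 ≤ S := Finset.sum_nonneg fun k _ => mul_self_nonneg _
  have hMS : 2 ^ (n + 1) * u * (|M i i| + S) ≤ 1 / 2 * (2 + S) := by gcongr
  have hM' := abs_le.1 hM
  have hs1 := abs_le.1 (hs'.trans hMS)
  -- From `0 < s ≤ 2 - S + (2 + S) / 2`.
  have hS6 : S ≤ 6 := by linarith
  have hs3 : s ≤ 3 := by linarith
  have hδ' := abs_le.1 hδ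
  have hrr : R i i * R i i - s = s * (δ * (2 + δ)) := by
    have := Real.mul_self_sqrt hs0.le
    rw [hr]
    linear_combination (1 + δ) ^ 2 * this
  have hrs : |R i i * R i i - s| ≤ 7 * u := by
    rw [hrr, abs_mul, abs_mul, abs_of_pos hs0]
    have : |2 + δ| ≤ 7 / 3 := abs_le.2 ⟨by linarith, by linarith⟩
    calc s * (|δ| * |2 + δ|) ≤ 3 * (u * (7 / 3)) := by gcongr
      _ = 7 * u := by ring
  refine ⟨?_, fun k => ?_, ?_⟩
  · rw [hr]
    exact mul_pos (Real.sqrt_pos.2 hs0) (by linarith)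
  · refine abs_le_of_sq_le_sq (a := R k i) (b := 3) ?_ (by norm_num)
    rcases lt_trichotomy k i with hk | rfl | hk
    · have : R k i * R k i ≤ S := Finset.single_le_sum (f := fun k => R k i * R k i)
        (fun k _ => mul_self_nonneg _) (Finset.mem_Iio.2 hk)
      nlinarith
    · nlinarith [(abs_le.1 hrs).2]
    · rw [hR0 k i hk]
      norm_num
  · rw [← sum_Iio_add_eq_sum_univ fun k hk => by rw [hR0 k i hk, zero_mul]]
    calc |S + R i i * R i i - M i i| = |(s - (M i i - S)) + (R i i * R i i - s)| := by ring_nf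
      _ ≤ |s - (M i i - S)| + |R i i * R i i - s| := abs_add_le _ _
      _ ≤ 2 ^ (n + 1) * u * (|M i i| + S) + 7 * u := add_le_add hs' hrs
      _ ≤ 2 ^ (n + 1) * u * (2 + 6) + 7 * u := by gcongr
      _ ≤ _ := by linarith

theorem FlCholesky.backward_error (h0 : 0 ≤ u) (hu : 2 ^ (n + 1) * u ≤ 1 / 2)
    (h : FlCholesky u M R) (hM : ∀ i j, |M i j| ≤ 2) {i j : Fin n} (hij : i ≤ j) :
    |(Rᵀ * R) i j - M i j| ≤ (2 ^ (n + 1) + 2) * (8 + 9 * n) * u := by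
  have hw := two_le_two_pow_succ n
  have hu4 : u ≤ 1 / 4 := by nlinarith
  have hn : (0 : ℝ) ≤ n := n.cast_nonneg
  have hi := h.diag_bounds h0 hu (hM i i)
  have hj := h.diag_bounds h0 hu (hM j j)
  simp only [mul_apply, transpose_apply]
  rcases hij.eq_or_lt with rfl | hij
  · refine hi.2.2.trans (mul_le_mul_of_nonneg_right ?_ h0)
    nlinarith
  obtain ⟨hR0, -, hRo⟩ := h
  obtain ⟨s, hs, hr⟩ := hRo i j hij
  have hs' := hs.abs_sub_le h0 (by linarith)
  have hsum : ∑ k ∈ Finset.Iio i, |R k i * R k j| ≤ n * 9 := by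
    refine sum_Iio_le_card_mul (by norm_num) fun k => ?_
    rw [abs_mul]
    nlinarith [hi.2.1 k, hj.2.1 k, abs_nonneg (R k i), abs_nonneg (R k j)]
  have hT := (Finset.abs_sum_le_sum_abs (fun k => R k i * R k j) (Finset.Iio i)).trans hsum
  rw [← sum_Iio_add_eq_sum_univ fun k hk => by rw [hR0 k i hk, zero_mul]]
  set T := ∑ k ∈ Finset.Iio i, R k i * R k j
  have hMb := hM i j
  have hb : 2 ^ (n + 1) * u * (|M i j| + ∑ k ∈ Finset.Iio i, |R k i * R k j|) ≤
      2 ^ (n + 1) * u * (2 + n * 9) := by gcongr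
  have hrs : R i i * R i j - s = R i i * (R i j - s / R i i) := by
    field_simp [hi.1.ne']
  have hrs' : |R i i * R i j - s| ≤ u * |s| := by
    rw [hrs, abs_mul]
    calc |R i i| * |R i j - s / R i i| ≤ |R i i| * (u * |s / R i i|) := by
          gcongr
          exact hr.abs_sub_le
      _ = u * |s| := by
          rw [abs_div]
          field_simp [(abs_pos.2 hi.1.ne').ne']
  have hsb : |s| ≤ 2 * (2 + n * 9) := by
    have e1 : 2 ^ (n + 1) * u * (2 + n * 9) ≤ 1 / 2 * (2 + (n : ℝ) * 9) := by gcongr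
    have e2 := abs_le.1 (hs'.trans (hb.trans e1))
    have e3 := abs_le.1 hMb
    have e4 := abs_le.1 hT
    exact abs_le.2 ⟨by linarith, by linarith⟩
  calc |T + R i i * R i j - M i j| = |(s - (M i j - T)) + (R i i * R i j - s)| := by ring_nf
    _ ≤ |s - (M i j - T)| + |R i i * R i j - s| := abs_add_le _ _
    _ ≤ 2 ^ (n + 1) * u * (2 + n * 9) + u * (2 * (2 + n * 9)) :=
        add_le_add (hs'.trans hb) (hrs'.trans (by gcongr))
    _ = (2 ^ (n + 1) + 2) * (2 + 9 * n) * u := by ring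
    _ ≤ _ := by gcongr; norm_num

/-- The residual is taken against the unconverted `R`, so it includes the conversion error. The
bound `q` on `Q` stays a parameter, since no bound is available yet. -/
theorem FlTriSolve.backward_error {m : ℕ} {A Q : Matrix (Fin m) (Fin n) ℝ}
    {R' : Matrix (Fin n) (Fin n) ℝ} (h0 : 0 ≤ u) (hu : 2 ^ (n + 1) * u ≤ 1 / 2)
    (hR0 : ∀ i j, j < i → R i j = 0) (hRpos : ∀ i, 0 < R i i) (hR : ∀ i j, |R i j| ≤ 3)
    (hR' : FlCast u R R') (h : FlTriSolve u A R' Q) (hA : ∀ i j, |A i j| ≤ 1)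
    {q : ℝ} (hq : ∀ i j, |Q i j| ≤ q) (l : Fin m) (j : Fin n) :
    |(Q * R) l j - A l j| ≤ (2 ^ (n + 1) + 2) * (1 + 9 * n) * u * (1 + q) := by
  have hw := two_le_two_pow_succ n
  have hu4 : u ≤ 1 / 4 := by nlinarith
  have hn : (0 : ℝ) ≤ n := n.cast_nonneg
  have hq0 : 0 ≤ q := (abs_nonneg _).trans (hq l j)
  have hd : ∀ k, |R' k j - R k j| ≤ 3 * u := fun k =>
    (hR' k j).abs_sub_le.trans (by nlinarith [hR k j])
  have hR6 : ∀ k, |R' k j| ≤ 6 := fun k => by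
    have := abs_sub_abs_le_abs_sub (R' k j) (R k j)
    linarith [hd k, hR k j]
  have hjj : R' j j ≠ 0 := by
    obtain ⟨δ, hδ, e⟩ := hR' j j
    rw [e]
    exact (mul_pos (hRpos j) (by linarith [(abs_le.1 hδ).1])).ne'
  obtain ⟨s, hs, hr⟩ := h l j
  have hs' := hs.abs_sub_le h0 (by linarith)
  have hsum : ∑ k ∈ Finset.Iio j, |Q l k * R' k j| ≤ n * (6 * q) := by
    refine sum_Iio_le_card_mul (by positivity) fun k => ?_
    rw [abs_mul, mul_comm]
    exact mul_le_mul (hR6 k) (hq l k) (abs_nonneg _) (by norm_num)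
  have hT := (Finset.abs_sum_le_sum_abs (fun k => Q l k * R' k j) (Finset.Iio j)).trans hsum
  have hdiff : |∑ k, Q l k * (R' k j - R k j)| ≤ n * (q * (3 * u)) := by
    refine (Finset.abs_sum_le_sum_abs _ _).trans ?_
    refine (Finset.sum_le_card_nsmul _ _ (q * (3 * u)) fun k _ => ?_).trans (by simp)
    rw [abs_mul]
    exact mul_le_mul (hq l k) (hd k) (abs_nonneg _) hq0
  have hR'0 : ∀ k, j < k → Q l k * R' k j = 0 := fun k hk => by
    obtain ⟨δ, -, e⟩ := hR' k j
    rw [e, hR0 k j hk]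
    ring
  have hQR : (Q * R) l j = ∑ k ∈ Finset.Iio j, Q l k * R' k j + Q l j * R' j j -
      ∑ k, Q l k * (R' k j - R k j) := by
    rw [sum_Iio_add_eq_sum_univ hR'0, mul_apply, ← Finset.sum_sub_distrib]
    exact Finset.sum_congr rfl fun k _ => by ring
  rw [hQR]
  set T := ∑ k ∈ Finset.Iio j, Q l k * R' k j
  set E := ∑ k, Q l k * (R' k j - R k j)
  have hAb := hA l j
  have hb : 2 ^ (n + 1) * u * (|A l j| + ∑ k ∈ Finset.Iio j, |Q l k * R' k j|) ≤
      2 ^ (n + 1) * u * (1 + n * (6 * q)) := by gcongr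
  have hrs : Q l j * R' j j - s = R' j j * (Q l j - s / R' j j) := by
    field_simp
  have hrs' : |Q l j * R' j j - s| ≤ u * |s| := by
    rw [hrs, abs_mul]
    calc |R' j j| * |Q l j - s / R' j j| ≤ |R' j j| * (u * |s / R' j j|) := by
          gcongr
          exact hr.abs_sub_le
      _ = u * |s| := by
          rw [abs_div]
          field_simp [(abs_pos.2 hjj).ne']
  have hsb : |s| ≤ 2 * (1 + n * (6 * q)) := by
    have e1 : 2 ^ (n + 1) * u * (1 + n * (6 * q)) ≤ 1 / 2 * (1 + n * (6 * q)) := by gcongr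
    have e2 := abs_le.1 (hs'.trans (hb.trans e1))
    have e3 := abs_le.1 hAb
    have e4 := abs_le.1 hT
    have e5 : 0 ≤ n * (6 * q) := by positivity
    exact abs_le.2 ⟨by linarith, by linarith⟩
  calc |T + Q l j * R' j j - E - A l j|
      = |(s - (A l j - T)) + (Q l j * R' j j - s) + -E| := by ring_nf
    _ ≤ |s - (A l j - T)| + |Q l j * R' j j - s| + |-E| :=
        (abs_add_le _ _).trans (add_le_add (abs_add_le _ _) le_rfl)
    _ ≤ 2 ^ (n + 1) * u * (1 + n * (6 * q)) + u * (2 * (1 + n * (6 * q))) + n * (q * (3 * u)) := by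
        rw [abs_neg]
        exact add_le_add (add_le_add (hs'.trans hb) (hrs'.trans (by gcongr))) hdiff
    _ = u * ((2 ^ (n + 1) + 2) * (1 + n * (6 * q)) + 3 * (n * q)) := by ring
    _ ≤ u * ((2 ^ (n + 1) + 2) * ((1 + 9 * n) * (1 + q))) := by
        have hnq : 0 ≤ n * q := by positivity
        gcongr
        generalize (2 : ℝ) ^ (n + 1) = w at *
        nlinarith [mul_nonneg (by linarith : 0 ≤ w + 2) hnq,
          mul_nonneg (by linarith : 0 ≤ w + 2) hq0, mul_nonneg (by linarith : 0 ≤ w + 2) hn]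
    _ = _ := by ring

end Cholesky

/-! ### Error of the Gram matrix for unit columns -/

theorem sum_sq_eq_one_of_colNorm {m n : ℕ} {B : Matrix (Fin m) (Fin n) ℝ} {j : Fin n}
    (h : colNorm B j = 1) : ∑ k, B k j ^ 2 = 1 := by
  have h2 := EuclideanSpace.norm_sq_eq (WithLp.toLp 2 (B.col j))
  rw [colNorm] at h
  rw [h] at h2
  simpa using h2.symm

theorem FlGram.abs_sub_le {m n : ℕ} {u : ℝ} {B : Matrix (Fin m) (Fin n) ℝ}
    {M : Matrix (Fin n) (Fin n) ℝ} (h0 : 0 ≤ u) (h1 : u ≤ 1) (hB : ∀ j, colNorm B j = 1)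
    (h : FlGram u B M) (i j : Fin n) :
    |M i j - (Bᵀ * B) i j| ≤ 2 ^ (m + 1) * u ∧ |(Bᵀ * B) i j| ≤ 1 := by
  -- By `|xy| ≤ (x² + y²) / 2`, the error relative to this sum becomes absolute.
  have key : ∀ i j, ∑ k, |B k i * B k j| ≤ 1 := fun i j => by
    have : ∑ k, |B k i * B k j| ≤ ∑ k, (B k i ^ 2 + B k j ^ 2) / 2 := by
      refine Finset.sum_le_sum fun k _ => ?_
      rw [abs_mul, ← sq_abs (B k i), ← sq_abs (B k j)]
      nlinarith [sq_nonneg (|B k i| - |B k j|)]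
    refine this.trans_eq ?_
    rw [← Finset.sum_div, Finset.sum_add_distrib, sum_sq_eq_one_of_colNorm (hB i),
      sum_sq_eq_one_of_colNorm (hB j)]
    norm_num
  refine ⟨?_, (Finset.abs_sum_le_sum_abs _ _).trans (key i j)⟩
  have main : ∀ i j, i ≤ j → |M i j - (Bᵀ * B) i j| ≤ 2 ^ (m + 1) * u := fun i j hij =>
    ((h.2 i j hij).abs_sub_le h0 h1).trans
      (mul_le_of_le_one_right (by positivity) (key i j))
  rcases le_total i j with hij | hij
  · exact main i j hij
  · have hB' : (Bᵀ * B) j i = (Bᵀ * B) i j := by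
      simp only [mul_apply, transpose_apply, mul_comm]
    rw [← hB', ← h.1.apply i j]
    exact main j i hij

/-! ### Spectral norm and perturbation bound -/

section OperatorNorm

variable {m n : ℕ}

theorem l2_opNorm_transpose (A : Matrix (Fin m) (Fin n) ℝ) : ‖Aᵀ‖ = ‖A‖ := by
  rw [← conjTranspose_eq_transpose_of_trivial, l2_opNorm_conjTranspose]

theorem l2_opNorm_transpose_mul_self (A : Matrix (Fin m) (Fin n) ℝ) : ‖Aᵀ * A‖ = ‖A‖ ^ 2 := by
  rw [← conjTranspose_eq_transpose_of_trivial, l2_opNorm_conjTranspose_mul_self, sq]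

theorem colNorm_le_l2_opNorm (A : Matrix (Fin m) (Fin n) ℝ) (j : Fin n) : colNorm A j ≤ ‖A‖ := by
  have h := A.l2_opNorm_mulVec (EuclideanSpace.single j 1)
  simpa [colNorm] using h

theorem abs_apply_le_l2_opNorm (A : Matrix (Fin m) (Fin n) ℝ) (i : Fin m) (j : Fin n) :
    |A i j| ≤ ‖A‖ :=
  (PiLp.norm_apply_le (WithLp.toLp 2 (A.col j)) i).trans (colNorm_le_l2_opNorm A j)

theorem l2_opNorm_single (i : Fin m) (j : Fin n) (x : ℝ) : ‖single i j x‖ = |x| := by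
  rw [← sq_eq_sq₀ (norm_nonneg _) (abs_nonneg _), ← l2_opNorm_transpose_mul_self, sq_abs,
    transpose_single, single_mul_single_same, ← diagonal_single, l2_opNorm_diagonal,
    Pi.norm_single, Real.norm_eq_abs, abs_mul_self, sq]

theorem l2_opNorm_le_of_abs_apply_le {A : Matrix (Fin m) (Fin n) ℝ} {ε : ℝ}
    (h : ∀ i j, |A i j| ≤ ε) : ‖A‖ ≤ m * n * ε := by
  rw [matrix_eq_sum_single A]
  calc ‖∑ i, ∑ j, single i j (A i j)‖ ≤ ∑ _i : Fin m, ∑ _j : Fin n, ε :=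
        norm_sum_le_of_le _ fun i _ => norm_sum_le_of_le _ fun j _ => by
          rw [l2_opNorm_single]
          exact h i j
    _ = m * n * ε := by simp [mul_assoc]

theorem isUnit_det_transpose_mul_self {B : Matrix (Fin m) (Fin n) ℝ}
    (h : LinearIndependent ℝ B.col) : IsUnit (Bᵀ * B).det := by
  rw [← isUnit_iff_isUnit_det, ← conjTranspose_eq_transpose_of_trivial]
  exact (PosDef.conjTranspose_mul_self B (mulVec_injective_iff.2 h)).isUnit

/-- Because `(BᵀB)⁻¹ = B† (B†)ᵀ`. -/
theorem l2_opNorm_pinv_sq {B : Matrix (Fin m) (Fin n) ℝ} (h : IsUnit (Bᵀ * B).det) :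
    ‖(Bᵀ * B)⁻¹‖ = ‖pinv B‖ ^ 2 := by
  rw [← l2_opNorm_transpose (pinv B), ← l2_opNorm_transpose_mul_self, pinv, transpose_transpose,
    transpose_mul, transpose_transpose, transpose_nonsing_inv, transpose_mul, transpose_transpose,
    Matrix.mul_assoc, ← Matrix.mul_assoc Bᵀ, mul_nonsing_inv _ h, Matrix.mul_one]

theorem l2_opNorm_pinv_le_condNumber {B : Matrix (Fin m) (Fin n) ℝ} (hB : ∀ j, colNorm B j = 1)
    (j : Fin n) : ‖pinv B‖ ≤ condNumber B :=
  le_mul_of_one_le_left (norm_nonneg _) ((hB j).symm.le.trans (colNorm_le_l2_opNorm B j))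

theorem one_le_condNumber {B : Matrix (Fin m) (Fin n) ℝ} (h : IsUnit (Bᵀ * B).det)
    (j : Fin n) : 1 ≤ condNumber B := by
  have : Nonempty (Fin n) := ⟨j⟩
  have h1 : pinv B * B = 1 := by rw [pinv, Matrix.mul_assoc, nonsing_inv_mul _ h]
  have h2 : ‖(1 : Matrix (Fin n) (Fin n) ℝ)‖ = 1 := by
    rw [← diagonal_one, l2_opNorm_diagonal]
    simp
  calc 1 = ‖pinv B * B‖ := by rw [h1, h2]
    _ ≤ ‖pinv B‖ * ‖B‖ := l2_opNorm_mul _ _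
    _ = condNumber B := mul_comm _ _

/-- If `Rᵀ R` is close to `Bᵀ B` and `Q R` is close to `B`, then `Q` is close to orthonormal. -/
theorem l2_opNorm_transpose_mul_self_sub_one_le {B Q : Matrix (Fin m) (Fin n) ℝ}
    {R : Matrix (Fin n) (Fin n) ℝ} (hB : IsUnit (Bᵀ * B).det) (hR : IsUnit R.det) {f g : ℝ}
    (hf : ‖Rᵀ * R - Bᵀ * B‖ ≤ f) (hg : ‖Q * R - B‖ ≤ g * (1 + ‖Q‖))
    (hf' : ‖pinv B‖ ^ 2 * f ≤ 1 / 4) (hg' : ‖pinv B‖ * g ≤ 1 / 8) :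
    ‖Qᵀ * Q - 1‖ ≤ 2 * ‖pinv B‖ ^ 2 * f + 40 * (‖pinv B‖ * g) := by
  set β := ‖pinv B‖
  have hβ0 : 0 ≤ β := norm_nonneg _
  set F := Rᵀ * R - Bᵀ * B with hF
  have hRt : IsUnit Rᵀ.det := by rwa [det_transpose]
  have hH : IsUnit (Rᵀ * R).det := by
    rw [det_mul]
    exact hRt.mul hR
  have hHinv : ‖(Rᵀ * R)⁻¹‖ = ‖R⁻¹‖ ^ 2 := by
    rw [Matrix.mul_inv_rev, ← l2_opNorm_transpose R⁻¹, ← l2_opNorm_transpose_mul_self,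
      transpose_transpose, transpose_nonsing_inv]
  have hf0 : 0 ≤ f := (norm_nonneg _).trans hf
  have hρ : ‖R⁻¹‖ ^ 2 ≤ 2 * β ^ 2 := by
    -- Resolvent identity; as `β² f ≤ 1/4`, its last term is absorbed on the left.
    have e : (Rᵀ * R)⁻¹ = (Bᵀ * B)⁻¹ - (Bᵀ * B)⁻¹ * F * (Rᵀ * R)⁻¹ := by
      rw [hF, Matrix.mul_sub, Matrix.sub_mul, nonsing_inv_mul _ hB, Matrix.one_mul,
        Matrix.mul_assoc (Bᵀ * B)⁻¹, mul_nonsing_inv _ hH, Matrix.mul_one, sub_sub_cancel]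
    have h1 : ‖(Rᵀ * R)⁻¹‖ ≤ β ^ 2 + β ^ 2 * f * ‖(Rᵀ * R)⁻¹‖ := by
      calc ‖(Rᵀ * R)⁻¹‖ = ‖(Bᵀ * B)⁻¹ - (Bᵀ * B)⁻¹ * F * (Rᵀ * R)⁻¹‖ := congrArg _ e
        _ ≤ ‖(Bᵀ * B)⁻¹‖ + ‖(Bᵀ * B)⁻¹‖ * ‖F‖ * ‖(Rᵀ * R)⁻¹‖ := by
          refine (norm_sub_le _ _).trans (add_le_add le_rfl ((l2_opNorm_mul _ _).trans ?_))
          gcongr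
          exact l2_opNorm_mul _ _
        _ ≤ β ^ 2 + β ^ 2 * f * ‖(Rᵀ * R)⁻¹‖ := by
          rw [l2_opNorm_pinv_sq hB]
          gcongr
    rw [hHinv] at h1
    nlinarith [sq_nonneg ‖R⁻¹‖]
  have hρ' : ‖R⁻¹‖ ≤ 2 * β := by
    refine (sq_le_sq₀ (norm_nonneg _) (by positivity)).1 ?_
    nlinarith
  set X := B * R⁻¹ with hX
  set Y := (Q * R - B) * R⁻¹ with hY
  have hQ : Q = X + Y := by
    rw [hX, hY, ← Matrix.add_mul, add_sub_cancel, Matrix.mul_assoc, mul_nonsing_inv _ hR,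
      Matrix.mul_one]
  have hXX : Xᵀ * X - 1 = -((R⁻¹)ᵀ * F * R⁻¹) := by
    have e : (R⁻¹)ᵀ * (Rᵀ * R) * R⁻¹ = 1 := by
      rw [Matrix.mul_assoc, Matrix.mul_assoc, mul_nonsing_inv _ hR, Matrix.mul_one,
        ← transpose_mul, mul_nonsing_inv _ hR, transpose_one]
    rw [hF, Matrix.mul_sub, Matrix.sub_mul, e, hX, transpose_mul, neg_sub]
    simp only [Matrix.mul_assoc]
  have hXX' : ‖Xᵀ * X - 1‖ ≤ 2 * β ^ 2 * f := by
    rw [hXX, norm_neg]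
    calc ‖(R⁻¹)ᵀ * F * R⁻¹‖ ≤ ‖(R⁻¹)ᵀ‖ * ‖F‖ * ‖R⁻¹‖ :=
          (l2_opNorm_mul _ _).trans (by gcongr; exact l2_opNorm_mul _ _)
      _ = ‖R⁻¹‖ ^ 2 * ‖F‖ := by rw [l2_opNorm_transpose]; ring
      _ ≤ 2 * β ^ 2 * f := by gcongr
  have h1 : ‖(1 : Matrix (Fin n) (Fin n) ℝ)‖ ≤ 1 := by
    rw [← diagonal_one, l2_opNorm_diagonal]
    exact (pi_norm_le_iff_of_nonneg zero_le_one).2 fun _ => by simp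
  have hX2 : ‖X‖ ≤ 2 := by
    have : ‖X‖ ^ 2 ≤ 2 := by
      rw [← l2_opNorm_transpose_mul_self]
      calc ‖Xᵀ * X‖ = ‖(Xᵀ * X - 1) + 1‖ := by rw [sub_add_cancel]
        _ ≤ ‖Xᵀ * X - 1‖ + ‖(1 : Matrix (Fin n) (Fin n) ℝ)‖ := norm_add_le _ _
        _ ≤ 2 := by linarith
    nlinarith [norm_nonneg X]
  have hYq : ‖Y‖ ≤ 2 * (β * g) * (1 + ‖Q‖) := by
    calc ‖Y‖ ≤ ‖Q * R - B‖ * ‖R⁻¹‖ := l2_opNorm_mul _ _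
      _ ≤ (g * (1 + ‖Q‖)) * (2 * β) := by gcongr; exact (norm_nonneg _).trans hg
      _ = _ := by ring
  -- This closes the circular bound: `‖Q‖ ≤ 2 + (1 + ‖Q‖) / 4`.
  have hq3 : ‖Q‖ ≤ 3 := by
    have e1 : ‖Q‖ ≤ ‖X‖ + ‖Y‖ := (congrArg _ hQ).trans_le (norm_add_le _ _)
    have e2 : 2 * (β * g) * (1 + ‖Q‖) ≤ 1 / 4 * (1 + ‖Q‖) := by
      gcongr
      linarith
    linarith
  have hg0 : 0 ≤ g := by
    have := (norm_nonneg _).trans hg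
    exact nonneg_of_mul_nonneg_left this (by positivity)
  have hβg : 0 ≤ β * g := by positivity
  have hY8 : ‖Y‖ ≤ 8 * (β * g) := by nlinarith
  have hexp : Qᵀ * Q - 1 = (Xᵀ * X - 1) + Xᵀ * Y + Yᵀ * X + Yᵀ * Y := by
    rw [hQ, transpose_add, Matrix.add_mul, Matrix.mul_add, Matrix.mul_add]
    abel
  have hmul : ∀ U V : Matrix (Fin m) (Fin n) ℝ, ‖Uᵀ * V‖ ≤ ‖U‖ * ‖V‖ := fun U V => by
    simpa only [l2_opNorm_transpose] using l2_opNorm_mul Uᵀ V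
  calc ‖Qᵀ * Q - 1‖ ≤ ‖Xᵀ * X - 1‖ + ‖Xᵀ * Y‖ + ‖Yᵀ * X‖ + ‖Yᵀ * Y‖ := by
        rw [hexp]
        exact norm_add₄_le
    _ ≤ 2 * β ^ 2 * f + ‖X‖ * ‖Y‖ + ‖Y‖ * ‖X‖ + ‖Y‖ * ‖Y‖ := by
        gcongr <;> exact hmul _ _
    -- `‖Y‖ ≤ 8βg ≤ 1` bounds one factor of the quadratic term, whence `40 = 16 + 16 + 8`.
    _ ≤ 2 * β ^ 2 * f + 2 * (8 * (β * g)) + (8 * (β * g)) * 2 + 1 * (8 * (β * g)) := by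
        gcongr
        linarith
    _ = _ := by ring

end OperatorNorm

/-! ### Assembly of the bounds -/

theorem IsColumnScaling.linearIndependent {m n : ℕ} {A B : Matrix (Fin m) (Fin n) ℝ}
    {D : Matrix (Fin n) (Fin n) ℝ} (h : IsColumnScaling A B D) (hA : LinearIndependent ℝ A.col) :
    LinearIndependent ℝ B.col := by
  obtain ⟨hAB, -, rfl⟩ := h
  have hpos := fun j => colNorm_pos (hA.ne_zero j)
  convert hA.units_smul fun j => (Units.mk0 _ (hpos j).ne')⁻¹ using 1
  ext j i
  have := congrFun (congrFun hAB i) j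
  rw [mul_diagonal] at this
  simp only [Pi.smul_apply', Pi.smul_apply, Units.smul_def, smul_eq_mul, col_apply, this,
    Units.val_inv_eq_inv_val, Units.val_mk0]
  field_simp [(hpos j).ne']

/-- Loss of orthogonality of mixed precision Cholesky QR for a matrix with unit columns. -/
theorem exists_orthogonality_bound (m n : ℕ) : ∃ K : ℝ, 1 ≤ K ∧
    ∀ uh u : ℝ, 0 < uh → 0 < u → ∀ B Q : Matrix (Fin m) (Fin n) ℝ,
      (∀ j, colNorm B j = 1) → LinearIndependent ℝ B.col →
      K * uh * condNumber B ^ 2 ≤ 1 → K * u * condNumber B ≤ 1 →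
      IsMixedCholeskyQR uh u B Q →
      ‖Qᵀ * Q - 1‖ ≤ K * (uh * condNumber B ^ 2 + u * condNumber B) := by
  set W : ℝ := 2 ^ (n + 1)
  set V : ℝ := 2 ^ (m + 1)
  have hW2 : 2 ≤ W := two_le_two_pow_succ n
  have hV2 : 2 ≤ V := two_le_two_pow_succ m
  set a : ℝ := n * n * (V + (W + 2) * (8 + 9 * n))
  set b : ℝ := m * n * ((W + 2) * (1 + 9 * n)) with hb
  have ha0 : 0 ≤ a := by positivity
  have hb0 : 0 ≤ b := by positivity
  -- `V` and `2 * W` make the rounding lemmas applicable; `4 * a` and `40 * b` give the smallness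
  -- conditions of the perturbation bound and dominate its constants.
  refine ⟨V + 2 * W + 4 * a + 40 * b, by linarith, ?_⟩
  set K := V + 2 * W + 4 * a + 40 * b
  intro uh u huh hu B Q hB hLI h1 h2 hQ
  -- For `n = 0`, `κ ≥ 1` fails but the matrix to bound is empty.
  rcases isEmpty_or_nonempty (Fin n) with _ | ⟨⟨j₀⟩⟩
  · have : 0 ≤ condNumber B := mul_nonneg (norm_nonneg _) (norm_nonneg _)
    rw [Subsingleton.elim (Qᵀ * Q - 1) 0, norm_zero]
    have : 0 ≤ K := by positivity
    positivity
  have hdet := isUnit_det_transpose_mul_self hLI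
  have hκ1 := one_le_condNumber hdet j₀
  have hβκ := l2_opNorm_pinv_le_condNumber hB j₀
  set κ := condNumber B
  set β := ‖pinv B‖
  have hβ0 : 0 ≤ β := norm_nonneg _
  have hK0 : 0 ≤ K := by positivity
  have hKuh : K * uh ≤ 1 :=
    (le_mul_of_one_le_right (by positivity) (one_le_pow₀ hκ1)).trans h1
  have hKu : K * u ≤ 1 := (le_mul_of_one_le_right (by positivity) hκ1).trans h2
  have hWuh : W * uh ≤ 1 / 2 := by nlinarith [mul_nonneg ha0 huh.le, mul_nonneg hb0 huh.le]
  have hWu : W * u ≤ 1 / 2 := by nlinarith [mul_nonneg ha0 hu.le, mul_nonneg hb0 hu.le]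
  have hVuh : V * uh ≤ 1 := by nlinarith [mul_nonneg ha0 huh.le, mul_nonneg hb0 huh.le]
  have huh1 : uh ≤ 1 := by nlinarith
  obtain ⟨M, R, R', hM, hR, hR', hS⟩ := hQ
  have hgram := hM.abs_sub_le huh.le huh1 hB
  have hM2 : ∀ i j, |M i j| ≤ 2 := fun i j => by
    have := abs_sub_abs_le_abs_sub (M i j) ((Bᵀ * B) i j)
    linarith [(hgram i j).1, (hgram i j).2]
  have hdiag := fun i => hR.diag_bounds huh.le hWuh (hM2 i i)
  have hRdet : IsUnit R.det := by
    rw [det_of_isUpperTriangular fun i j hij => hR.1 i j hij, isUnit_iff_ne_zero]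
    exact Finset.prod_ne_zero_iff.2 fun i _ => (hdiag i).1.ne'
  have hF : ‖Rᵀ * R - Bᵀ * B‖ ≤ a * uh := by
    have main : ∀ i j, i ≤ j →
        |(Rᵀ * R - Bᵀ * B) i j| ≤ (V + (W + 2) * (8 + 9 * n)) * uh := fun i j hij => by
      have e1 := hR.backward_error huh.le hWuh hM2 hij
      have e2 := (hgram i j).1
      calc |(Rᵀ * R - Bᵀ * B) i j|
          = |((Rᵀ * R) i j - M i j) + (M i j - (Bᵀ * B) i j)| := by
            rw [Matrix.sub_apply, sub_add_sub_cancel]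
        _ ≤ _ := (abs_add_le _ _).trans (by linarith)
    refine (l2_opNorm_le_of_abs_apply_le fun i j => ?_).trans_eq
      (mul_assoc _ _ _).symm
    rcases le_total i j with hij | hij
    · exact main i j hij
    · have hsymm : (Rᵀ * R - Bᵀ * B) i j = (Rᵀ * R - Bᵀ * B) j i := by
        simp only [Matrix.sub_apply, mul_apply, transpose_apply, mul_comm]
      rw [hsymm]
      exact main j i hij
  have hG : ‖Q * R - B‖ ≤ b * u * (1 + ‖Q‖) := by
    refine (l2_opNorm_le_of_abs_apply_le fun l j => FlTriSolve.backward_error hu.le hWu hR.1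
      (fun i => (hdiag i).1) (fun i j => (hdiag j).2.1 i) hR' hS
      (fun i j => (abs_le_one_iff_mul_self_le_one.2 ?_)) (abs_apply_le_l2_opNorm Q) l j).trans_eq
      (by rw [hb]; ring)
    rw [← sum_sq_eq_one_of_colNorm (hB j), ← sq]
    exact Finset.single_le_sum (f := fun k => B k j ^ 2) (fun k _ => sq_nonneg _)
      (Finset.mem_univ i)
  have hβ2 : β ^ 2 ≤ κ ^ 2 := by gcongr
  have hx : β ^ 2 * (a * uh) ≤ κ ^ 2 * (a * uh) := by gcongr
  have hy : β * (b * u) ≤ κ * (b * u) := by gcongr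
  have p1 : 0 ≤ uh * κ ^ 2 := by positivity
  have p2 : 0 ≤ u * κ := by positivity
  have q1 : 4 * a * (uh * κ ^ 2) ≤ K * (uh * κ ^ 2) := by gcongr; linarith
  have q2 : 40 * b * (u * κ) ≤ K * (u * κ) := by gcongr; linarith
  have r1 : 0 ≤ a * (uh * κ ^ 2) := by positivity
  have r2 : 0 ≤ b * (u * κ) := by positivity
  refine (l2_opNorm_transpose_mul_self_sub_one_le hdet hRdet hF hG ?_ ?_).trans ?_
  · linarith
  · linarith
  · linarith

end

theorem mainTheorem4 (m n : ℕ) :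
    -- the computed Q-factors of A are exactly the computed Q-factors of B
    (∀ uh u : ℝ, 0 < uh → 0 < u →
      ∀ (A B : Matrix (Fin m) (Fin n) ℝ) (D : Matrix (Fin n) (Fin n) ℝ),
        IsColumnScaling A B D → (∀ j, A.col j ≠ 0) →
        ∀ Q, IsMixedCholeskyQR uh u A Q ↔ IsMixedCholeskyQR uh u B Q) ∧
    -- u_h = O(u^2)
    (∀ c : ℝ, 0 < c → ∃ C₁ C₂ : ℝ, 0 < C₁ ∧ 0 < C₂ ∧
      ∀ uh u : ℝ, 0 < uh → 0 < u → uh ≤ c * u ^ 2 →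
      ∀ (A B : Matrix (Fin m) (Fin n) ℝ) (D : Matrix (Fin n) (Fin n) ℝ),
        IsColumnScaling A B D → LinearIndependent ℝ A.col →
        C₁ * u * condNumber B ≤ 1 →
        ∀ Q, IsMixedCholeskyQR uh u A Q →
          ‖Q.transpose * Q - 1‖ ≤ C₂ * u * condNumber B) ∧
    -- u_h = u
    (∃ C₁ C₂ : ℝ, 0 < C₁ ∧ 0 < C₂ ∧
      ∀ u : ℝ, 0 < u →
      ∀ (A B : Matrix (Fin m) (Fin n) ℝ) (D : Matrix (Fin n) (Fin n) ℝ),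
        IsColumnScaling A B D → LinearIndependent ℝ A.col →
        C₁ * u * condNumber B ^ 2 ≤ 1 →
        ∀ Q, IsMixedCholeskyQR u u A Q →
          ‖Q.transpose * Q - 1‖ ≤ C₂ * u * condNumber B ^ 2) := by
  obtain ⟨K, hK1, hK⟩ := exists_orthogonality_bound m n
  have hK0 : 0 < K := by linarith
  refine ⟨fun uh u _ _ A B D h hA Q => isMixedCholeskyQR_iff_of_isColumnScaling h hA,
    -- With `x = u κ`, `K (1 + c) x ≤ 1` yields `x ≤ 1` and `K c x ≤ 1`, hence both hypotheses of
    -- the general bound.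
    fun c hc => ⟨K * (1 + c), K * (1 + c), by positivity, by positivity, ?_⟩,
    K, 2 * K, hK0, by positivity, ?_⟩
  · intro uh u huh hu hle A B D h hA hC Q hQ
    have hQB := (isMixedCholeskyQR_iff_of_isColumnScaling h hA.ne_zero).1 hQ
    have hκ : 0 ≤ condNumber B := mul_nonneg (norm_nonneg _) (norm_nonneg _)
    set κ := condNumber B
    set x := u * κ with hx
    have hx0 : 0 ≤ x := by positivity
    have hx1 : K * (1 + c) * x ≤ 1 := by linarith
    have hKx : K * x ≤ 1 := by nlinarith [mul_nonneg (mul_nonneg hK0.le hc.le) hx0]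
    have hcx : K * c * x ≤ 1 := by nlinarith [mul_nonneg hK0.le hx0]
    have hxle : x ≤ 1 := by nlinarith
    have huhx : uh * κ ^ 2 ≤ c * x ^ 2 := by
      calc uh * κ ^ 2 ≤ c * u ^ 2 * κ ^ 2 := by gcongr
        _ = c * x ^ 2 := by ring
    have hcx2 : c * x ^ 2 ≤ c * x := by
      gcongr
      nlinarith
    have hcond : K * uh * κ ^ 2 ≤ 1 := by
      calc K * uh * κ ^ 2 = K * (uh * κ ^ 2) := by ring
        _ ≤ K * (c * x) := by gcongr K * ?_; exact huhx.trans hcx2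
        _ ≤ 1 := by linarith
    refine (hK uh u huh hu B Q h.2.1 (h.linearIndependent hA) hcond (by linarith) hQB).trans ?_
    calc K * (uh * κ ^ 2 + u * κ) ≤ K * (c * x + x) := by
          gcongr K * (?_ + _)
          exact huhx.trans hcx2
      _ = K * (1 + c) * u * κ := by rw [hx]; ring
  · intro u hu A B D h hA hC Q hQ
    have hQB := (isMixedCholeskyQR_iff_of_isColumnScaling h hA.ne_zero).1 hQ
    have hLI := h.linearIndependent hA
    have hκ : condNumber B ≤ condNumber B ^ 2 := by
      rcases isEmpty_or_nonempty (Fin n) with _ | ⟨⟨j⟩⟩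
      · have : condNumber B = 0 := by
          rw [condNumber, Subsingleton.elim B 0, norm_zero, zero_mul]
        simp [this]
      · exact le_self_pow₀ (one_le_condNumber (isUnit_det_transpose_mul_self hLI) j) two_ne_zero
    have huκ : u * condNumber B ≤ u * condNumber B ^ 2 := by gcongr
    have hKuκ : K * (u * condNumber B) ≤ K * (u * condNumber B ^ 2) := by gcongr
    refine (hK u u hu hu B Q h.2.1 hLI hC (by linarith) hQB).trans ?_
    linarith
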